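/- Let $\Bbbk$ be a field and let $A$, $B$ be commutative Noetherian $\Bbbk$-algebras such that $R=A\otimes_\Bbbk B$ is also Noetherian. For an ideal $I$ of a commutative ring $S$ and a rational number $u=p/q\ge 0$ ($p\ge 0$, $q\ge 1$ integers), let $\overline{I^u}=\{x\in S \mid x^q\in\overline{I^p}\}$ denote the $u$-th rational power of $I$, where $\overline{I^p}$ is the integral closure of the ideal $I^p$; thus $\overline{I^0}=S$. For a further ideal $K$ of $S$, let $\overline{I^{(u)}_K}=\overline{I^u}:K^\infty=\bigcup_{t\ge 0}\left(\overline{I^u}:K^t\right)$ denote the $u$-th saturated power of $I$ with respect to $K$. For ideals $I\subseteq A$ and $J\subseteq B$ write $I+J$ for the ideal $IR+JR$ of $R$, and $IJ$ (also $I\cdot J$) for the ideal $(IR)(JR)$ of $R$. Theorem. Let $I,K\subseteq A$ and $J,L\subseteq B$ be ideals and let $u$ be a positive rational number. If the binomial expansion formula holds for $I$ and $J$ at power $u$, that is, if $$\overline{(I+J)^u}=\sum_{\substack{0\le w\le u\\ w\in\mathbb{Q}}}\overline{I^w}\cdot\overline{J^{u-w}},$$ then $$\overline{(I+J)^{(u)}_{KL}}=\sum_{\substack{0\le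 w\le u\\ w\in\mathbb{Q}}}\overline{I^{(w)}_K}\cdot\overline{J^{(u-w)}_L}.$$ -/

import Mathlib

open scoped TensorProduct Polynomial

namespace RatPower

/-- `x` is integral over the ideal `I`: it is a root of a monic polynomial
`X ^ n + a₁ X ^ (n - 1) + ⋯ + aₙ` with `aⱼ ∈ I ^ j` for every `j`. -/
def IsIntegralOver {R : Type*} [CommRing R] (I : Ideal R) (x : R) : Prop :=
  ∃ f : R[X], f.Monic ∧ (∀ i, f.coeff i ∈ I ^ (f.natDegree - i)) ∧ f.eval x = 0

/-- Auxiliary: the subalgebra of `R[X]` of all polynomials whose coefficient of `X ^ i` lies in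
`I ^ ⌈i / q⌉` (written without division). It serves only to prove that the sets defined below are
closed under addition. -/
def auxAlgebra {R : Type*} [CommRing R] (I : Ideal R) (q : ℕ) : Subalgebra R R[X] where
  carrier := {f | ∀ i n, q * n < i + q → f.coeff i ∈ I ^ n}
  mul_mem' := by
    intro f g hf hg i n hn
    rw [Polynomial.coeff_mul]
    refine Ideal.sum_mem _ fun c hc => ?_
    rw [Finset.HasAntidiagonal.mem_antidiagonal] at hc
    rcases Nat.eq_zero_or_pos q with rfl | hq
    · rcases Nat.eq_zero_or_pos c.1 with h1 | h1
      · exact Ideal.mul_mem_left _ _ (hg _ _ (by omega))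
      · exact Ideal.mul_mem_right _ _ (hf _ _ (by omega))
    · have key : n ≤ (c.1 + q - 1) / q + (c.2 + q - 1) / q := by
        have h1 := Nat.div_add_mod (c.1 + q - 1) q
        have h2 := Nat.div_add_mod (c.2 + q - 1) q
        have h3 := Nat.mod_lt (c.1 + q - 1) hq
        have h4 := Nat.mod_lt (c.2 + q - 1) hq
        by_contra! hlt
        have h5 : q * ((c.1 + q - 1) / q + (c.2 + q - 1) / q + 1) ≤ q * n :=
          Nat.mul_le_mul_left _ hlt
        rw [mul_add, mul_add] at h5
        omega
      refine Ideal.pow_le_pow_right key ?_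
      rw [pow_add]
      refine Ideal.mul_mem_mul (hf _ _ ?_) (hg _ _ ?_)
      · have := Nat.mul_div_le (c.1 + q - 1) q
        omega
      · have := Nat.mul_div_le (c.2 + q - 1) q
        omega
  add_mem' := by
    intro f g hf hg i n hn
    rw [Polynomial.coeff_add]
    exact Ideal.add_mem _ (hf i n hn) (hg i n hn)
  algebraMap_mem' := by
    intro r i n hn
    rw [Polynomial.algebraMap_apply, Algebra.algebraMap_self_apply, Polynomial.coeff_C]
    split_ifs with h
    · subst h
      have : n = 0 := by
        by_contra h0
        have : q * 1 ≤ q * n := Nat.mul_le_mul_left _ (Nat.one_le_iff_ne_zero.mpr h0)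
        omega
      simp [this]
    · exact Ideal.zero_mem _

theorem monomial_mem_auxAlgebra {R : Type*} [CommRing R] {I : Ideal R} {q m : ℕ} {r : R}
    (hr : r ∈ I ^ m) : Polynomial.monomial (q * m) r ∈ auxAlgebra I q := by
  intro i n hn
  rw [Polynomial.coeff_monomial]
  split_ifs with h
  · subst h
    refine Ideal.pow_le_pow_right ?_ hr
    have h' : q * n < q * (m + 1) := by rw [mul_add, mul_one]; exact hn
    exact Nat.lt_succ_iff.mp (Nat.lt_of_mul_lt_mul_left h')
  · exact Ideal.zero_mem _

theorem isIntegralOver_pow_iff {R : Type*} [CommRing R] (I : Ideal R) (p q : ℕ) (hq : 0 < q)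
    (x : R) : IsIntegralOver (I ^ p) (x ^ q) ↔
      IsIntegral (auxAlgebra I q) (Polynomial.monomial p x) := by
  constructor
  · rintro ⟨f, hmonic, hcoeff, heval⟩
    refine IsIntegral.of_pow hq ?_
    set n := f.natDegree with hn
    have hmem : ∀ i, Polynomial.monomial (q * (p * (n - i))) (f.coeff i) ∈ auxAlgebra I q :=
      fun i => monomial_mem_auxAlgebra (by rw [pow_mul]; exact hcoeff i)
    let c : ℕ → auxAlgebra I q := fun i => ⟨_, hmem i⟩
    have hcn : c n = 1 := by
      apply Subtype.ext
      have h1 : f.coeff n = 1 := hmonic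
      simp [c, h1]
    refine ⟨Polynomial.X ^ n + ∑ i ∈ Finset.range n, Polynomial.C (c i) * Polynomial.X ^ i,
      ?_, ?_⟩
    · refine Polynomial.monic_X_pow_add ?_
      rw [Polynomial.degree_lt_iff_coeff_zero]
      intro m hm
      rw [Polynomial.finsetSum_coeff]
      refine Finset.sum_eq_zero fun i hi => ?_
      rw [Polynomial.coeff_C_mul_X_pow, if_neg]
      have := Finset.mem_range.mp hi
      omega
    · have hstep : ∀ i ≤ n, (c i : R[X]) * (Polynomial.monomial p x ^ q) ^ i =
          Polynomial.monomial (q * (p * n)) (f.coeff i * (x ^ q) ^ i) := by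
        intro i hi
        change Polynomial.monomial (q * (p * (n - i))) (f.coeff i) * _ = _
        rw [Polynomial.monomial_pow, Polynomial.monomial_pow, Polynomial.monomial_mul_monomial]
        congr 2
        obtain ⟨d, hd⟩ := Nat.exists_eq_add_of_le hi
        rw [hd, Nat.add_sub_cancel_left]
        ring
      have hlast := hstep n le_rfl
      rw [hcn] at hlast
      have hall : (∑ i ∈ Finset.range n, (c i : R[X]) * (Polynomial.monomial p x ^ q) ^ i) +
          ((1 : auxAlgebra I q) : R[X]) * (Polynomial.monomial p x ^ q) ^ n = 0 := by
        rw [hlast, Finset.sum_congr rfl fun i hi => hstep i (Finset.mem_range.mp hi).le,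
          ← map_sum, ← map_add, ← Finset.sum_range_succ
            (fun i => f.coeff i * (x ^ q) ^ i) n, hn,
          ← Polynomial.eval_eq_sum_range, heval, map_zero]
      rw [Polynomial.eval₂_add, Polynomial.eval₂_finsetSum, Polynomial.eval₂_X_pow]
      simp only [Polynomial.eval₂_mul, Polynomial.eval₂_C, Polynomial.eval₂_X_pow]
      rw [add_comm]
      simpa using hall
  · intro h
    obtain ⟨g, hmonic, heval⟩ := h.pow q
    set n := g.natDegree with hn
    let a : ℕ → R := fun i => (g.coeff i : R[X]).coeff (q * (p * (n - i)))
    have ha : ∀ i, a i ∈ (I ^ p) ^ (n - i) := by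
      intro i
      rw [← pow_mul]
      exact (g.coeff i).2 _ _ (by omega)
    have han : a n = 1 := by
      have h1 : g.coeff n = 1 := hmonic
      simp [a, h1]
    let s : R[X] := ∑ i ∈ Finset.range n, Polynomial.C (a i) * Polynomial.X ^ i
    have hs : ∀ m, s.coeff m = if m < n then a m else 0 := by
      intro m
      simp only [s, Polynomial.finsetSum_coeff, Polynomial.coeff_C_mul_X_pow]
      simp
    rcases subsingleton_or_nontrivial R with hR | hR
    · exact ⟨1, Polynomial.monic_one, fun i => by
        rw [Subsingleton.elim ((1 : R[X]).coeff i) 0]; exact Ideal.zero_mem _,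
        Subsingleton.elim _ _⟩
    have hdeg : s.degree < n := by
      rw [Polynomial.degree_lt_iff_coeff_zero]
      intro m hm
      rw [hs, if_neg (by omega)]
    have hnat : (Polynomial.X ^ n + s).natDegree = n := by
      rw [Polynomial.natDegree_add_eq_left_of_degree_lt (by simpa using hdeg),
        Polynomial.natDegree_X_pow]
    refine ⟨Polynomial.X ^ n + s, Polynomial.monic_X_pow_add hdeg, ?_, ?_⟩
    · intro i
      rw [hnat, Polynomial.coeff_add, Polynomial.coeff_X_pow, hs]
      rcases lt_trichotomy i n with hi | hi | hi
      · rw [if_neg (by omega), if_pos hi, zero_add]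
        exact ha i
      · subst hi
        simp
      · rw [if_neg (by omega), if_neg (by omega), zero_add]
        exact Ideal.zero_mem _
    · have h0 := congrArg (fun r : R[X] => r.coeff (q * (p * n))) heval
      simp only [Polynomial.eval₂_eq_sum_range, Polynomial.finsetSum_coeff,
        Polynomial.coeff_zero] at h0
      have hterm : ∀ i ∈ Finset.range (n + 1),
          ((algebraMap (auxAlgebra I q) R[X]) (g.coeff i) *
            (Polynomial.monomial p x ^ q) ^ i).coeff (q * (p * n)) = a i * (x ^ q) ^ i := by
        intro i hi
        have hi' : i ≤ n := Nat.lt_succ_iff.mp (Finset.mem_range.mp hi)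
        have hd : q * (p * n) = q * (p * (n - i)) + p * q * i := by
          obtain ⟨d, hd⟩ := Nat.exists_eq_add_of_le hi'
          rw [hd, Nat.add_sub_cancel_left]
          ring
        rw [Polynomial.monomial_pow, Polynomial.monomial_pow, hd,
          Polynomial.coeff_mul_monomial]
        rfl
      rw [← hn, Finset.sum_congr rfl hterm, Finset.sum_range_succ, han] at h0
      simp only [s, Polynomial.eval_add, Polynomial.eval_pow, Polynomial.eval_X,
        Polynomial.eval_finsetSum, Polynomial.eval_mul, Polynomial.eval_C]
      rw [add_comm]
      simpa using h0

theorem isIntegralOver_pow_zero {R : Type*} [CommRing R] (I : Ideal R) (p q : ℕ) (hq : 0 < q) :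
    IsIntegralOver (I ^ p) ((0 : R) ^ q) := by
  rw [isIntegralOver_pow_iff I p q hq, map_zero]
  exact isIntegral_zero

theorem isIntegralOver_pow_add {R : Type*} [CommRing R] (I : Ideal R) (p q : ℕ) (hq : 0 < q)
    {x y : R} (hx : IsIntegralOver (I ^ p) (x ^ q)) (hy : IsIntegralOver (I ^ p) (y ^ q)) :
    IsIntegralOver (I ^ p) ((x + y) ^ q) := by
  rw [isIntegralOver_pow_iff I p q hq] at *
  rw [map_add]
  exact hx.add hy

theorem isIntegralOver_pow_smul {R : Type*} [CommRing R] (I : Ideal R) (p q : ℕ) (hq : 0 < q)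
    (r : R) {x : R} (hx : IsIntegralOver (I ^ p) (x ^ q)) :
    IsIntegralOver (I ^ p) ((r * x) ^ q) := by
  rw [isIntegralOver_pow_iff I p q hq] at *
  rw [← Polynomial.C_mul_monomial]
  exact (isIntegral_algebraMap (R := auxAlgebra I q)
    (x := algebraMap R (auxAlgebra I q) r)).mul hx

/-- The integral closure `Ī` of an ideal `I`. -/
def integralClosure {R : Type*} [CommRing R] (I : Ideal R) : Ideal R where
  carrier := {x | IsIntegralOver I x}
  zero_mem' := by simpa using isIntegralOver_pow_zero I 1 1 one_pos
  add_mem' := fun {x y} hx hy => by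
    have := isIntegralOver_pow_add I 1 1 one_pos (x := x) (y := y)
    simp only [pow_one] at this
    exact this hx hy
  smul_mem' := fun r x hx => by
    have := isIntegralOver_pow_smul I 1 1 one_pos r (x := x)
    simp only [pow_one] at this
    exact this hx

/-- The rational power of `I` with exponent `u = p / q` (in lowest terms): the ideal of all `x`
such that `x ^ q` lies in the integral closure of `I ^ p`. For `u = 0` it is the unit ideal. -/
def rationalPower {R : Type*} [CommRing R] (I : Ideal R) (u : ℚ≥0) : Ideal R where
  carrier := {x | x ^ u.den ∈ integralClosure (I ^ u.num)}
  zero_mem' := isIntegralOver_pow_zero I u.num u.den u.den_pos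
  add_mem' := fun hx hy => isIntegralOver_pow_add I u.num u.den u.den_pos hx hy
  smul_mem' := fun r _ hx => isIntegralOver_pow_smul I u.num u.den u.den_pos r hx

/-- The rational power may be computed from any presentation of `u` as a fraction. -/
theorem mem_rationalPower_iff {R : Type*} [CommRing R] (I : Ideal R) (u : ℚ≥0) (p q : ℕ)
    (hq : 0 < q) (hu : u = p / q) (x : R) :
    x ∈ rationalPower I u ↔ x ^ q ∈ integralClosure (I ^ p) := by
  have key : ∀ a b k : ℕ, 0 < k →
      (IsIntegralOver (I ^ a) (x ^ b) ↔ IsIntegralOver (I ^ (a * k)) (x ^ (b * k))) := by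
    intro a b k hk
    have h1 := isIntegralOver_pow_iff I a 1 one_pos (x ^ b)
    have h2 := isIntegralOver_pow_iff I (a * k) 1 one_pos (x ^ (b * k))
    rw [pow_one] at h1 h2
    rw [h1, h2, pow_mul x b k, ← Polynomial.monomial_pow]
    exact (IsIntegral.pow_iff hk).symm
  have hcross : u.num * q = p * u.den := by
    have hq' : (q : ℚ≥0) ≠ 0 := by exact_mod_cast hq.ne'
    have hd' : (u.den : ℚ≥0) ≠ 0 := by exact_mod_cast u.den_pos.ne'
    have h : (u.num : ℚ≥0) / u.den = p / q := by rw [NNRat.num_div_den, hu]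
    rw [div_eq_div_iff hd' hq'] at h
    exact_mod_cast h
  change IsIntegralOver (I ^ u.num) (x ^ u.den) ↔ IsIntegralOver (I ^ p) (x ^ q)
  rw [key u.num u.den q hq, key p q u.den u.den_pos, hcross, mul_comm q]

/-- The saturation `I : K ^ ∞`, the union of the colon ideals `I : K ^ t`. -/
def saturation {R : Type*} [CommRing R] (I K : Ideal R) : Ideal R where
  carrier := {x | ∃ t : ℕ, ∀ y ∈ K ^ t, x * y ∈ I}
  zero_mem' := ⟨0, fun y _ => by rw [zero_mul]; exact I.zero_mem⟩
  add_mem' := by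
    rintro x z ⟨s, hs⟩ ⟨t, ht⟩
    refine ⟨s + t, fun y hy => ?_⟩
    rw [add_mul]
    exact I.add_mem (hs y (Ideal.pow_le_pow_right (Nat.le_add_right s t) hy))
      (ht y (Ideal.pow_le_pow_right (Nat.le_add_left t s) hy))
  smul_mem' := by
    rintro r x ⟨t, ht⟩
    refine ⟨t, fun y hy => ?_⟩
    rw [smul_eq_mul, mul_assoc]
    exact I.mul_mem_left r (ht y hy)

/-- The saturated power of `I` with exponent `u` with respect to `K`. -/
def saturatedPower {R : Type*} [CommRing R] (I K : Ideal R) (u : ℚ≥0) : Ideal R :=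
  saturation (rationalPower I u) K

section Mixed

variable (k : Type*) {A B : Type*} [Field k] [CommRing A] [CommRing B] [Algebra k A] [Algebra k B]

/-- The extension to `A ⊗ B` of an ideal of `A`. -/
def extLeft (B : Type*) [CommRing B] [Algebra k B] (I : Ideal A) : Ideal (A ⊗[k] B) :=
  I.map (Algebra.TensorProduct.includeLeft : A →ₐ[k] A ⊗[k] B)

/-- The extension to `A ⊗ B` of an ideal of `B`. -/
def extRight (A : Type*) [CommRing A] [Algebra k A] (J : Ideal B) : Ideal (A ⊗[k] B) :=
  J.map (Algebra.TensorProduct.includeRight : B →ₐ[k] A ⊗[k] B)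

/-- The mixed sum `I + J`, that is, `I (A ⊗ B) + J (A ⊗ B)`. -/
def mixedSum (I : Ideal A) (J : Ideal B) : Ideal (A ⊗[k] B) :=
  extLeft k B I + extRight k A J

/-- The mixed product `K L`, that is, the product of the extensions of `K` and `L`. -/
def mixedProd (K : Ideal A) (L : Ideal B) : Ideal (A ⊗[k] B) :=
  extLeft k B K * extRight k A L

/-- The binomial expansion formula holds for `I` and `J` at power `u`. The sum of ideals over all
rational `w` with `0 ≤ w ≤ u` is their supremum. -/
def BinomialExpansion (I : Ideal A) (J : Ideal B) (u : ℚ≥0) : Prop :=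
  rationalPower (mixedSum k I J) u =
    ⨆ (w : ℚ≥0) (_ : w ≤ u), mixedProd k (rationalPower I w) (rationalPower J (u - w))

end Mixed

end RatPower

/-! Only two facts about rational powers matter: they decrease in the exponent, and exponent 0 gives
the unit ideal. Given the binomial hypothesis, the claim is then linear algebra over `k`: for a
decreasing chain `F` and an increasing chain `G` of subspaces, colons by powers of `K` and `L` pass
inside a finite sum of the `F i ⊗ G i`.

The reason is a dual description of this sum. If the sum contains `z`, then contracting `z` with a
functional on `B` that kills every `G j` with `j < i` lands in `F i`. Conversely, these conditions,
together with the vanishing of contractions by functionals killing every `G j`, force membership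
(`mem_iSup_map₂_of_contractRight`). Contraction commutes with linear maps of `A`, so preimages under
such maps, and intersections of them, act on each `F i` separately. Swapping factors gives the same
for `G`.

Noetherianity of the tensor product reduces the sum over all exponents to a finite one. The reverse
inclusion is a direct computation with pure tensors. -/

namespace RatPower

/-! ### Linear algebra of two opposite chains of subspaces -/

section Chain

variable {k A B : Type*} [Field k] [AddCommGroup A] [Module k A] [AddCommGroup B] [Module k B]

/-- Contraction of the right tensor factor against a linear functional. -/
noncomputable def contractRight (A : Type*) [AddCommGroup A] [Module k A] (φ : B →ₗ[k] k) :
    A ⊗[k] B →ₗ[k] A :=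
  (TensorProduct.rid k A).toLinearMap ∘ₗ φ.lTensor A

@[simp]
theorem contractRight_tmul (φ : B →ₗ[k] k) (a : A) (b : B) :
    contractRight A φ (a ⊗ₜ[k] b) = φ b • a := by
  simp [contractRight]

theorem contractRight_lTensor {B' : Type*} [AddCommGroup B'] [Module k B'] (φ : B' →ₗ[k] k)
    (p : B →ₗ[k] B') (z : A ⊗[k] B) :
    contractRight A φ (p.lTensor A z) = contractRight A (φ ∘ₗ p) z := by
  simp [contractRight, LinearMap.lTensor_comp]

theorem contractRight_rTensor {A' : Type*} [AddCommGroup A'] [Module k A'] (φ : B →ₗ[k] k)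
    (f : A →ₗ[k] A') (z : A ⊗[k] B) :
    contractRight A' φ (f.rTensor B z) = f (contractRight A φ z) := by
  induction z with
  | zero => simp
  | tmul a b => simp
  | add x y hx hy => simp only [map_add, hx, hy]

theorem exists_finset_eq_sum_contractRight {ι : Type*} (b : Module.Basis ι k B) (z : A ⊗[k] B) :
    ∃ s : Finset ι, z = ∑ i ∈ s, contractRight A (b.coord i) z ⊗ₜ[k] b i := by
  classical
  obtain ⟨c, rfl⟩ := TensorProduct.eq_repr_basis_right b z
  refine ⟨c.support, ?_⟩
  rw [Finsupp.sum]
  refine Finset.sum_congr rfl fun i hi => ?_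
  congr 1
  simp only [map_sum, contractRight_tmul, Module.Basis.coord_apply, Module.Basis.repr_self,
    Finsupp.single_apply, ite_smul, one_smul, zero_smul]
  rw [Finset.sum_ite_eq' c.support i, if_pos hi]

/-- A linear endomorphism projecting onto a given subspace. -/
theorem exists_projection (H : Submodule k B) :
    ∃ p : B →ₗ[k] B, (∀ x, p x ∈ H) ∧ ∀ x ∈ H, p x = x := by
  obtain ⟨g, hg⟩ := H.subtype.exists_leftInverse_of_injective H.ker_subtype
  exact ⟨H.subtype ∘ₗ g, fun x => (g x).2, fun x hx =>
    congrArg Subtype.val (LinearMap.congr_fun hg ⟨x, hx⟩)⟩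

/-- The second condition lets a projection onto `G` fix `z`; the first puts the coefficients of `z`
in a basis of `B` into `F`. -/
theorem mem_map₂_of_contractRight_mem (F : Submodule k A) (G : Submodule k B) (z : A ⊗[k] B)
    (hF : ∀ φ : B →ₗ[k] k, contractRight A φ z ∈ F)
    (hG : ∀ φ : B →ₗ[k] k, (∀ x ∈ G, φ x = 0) → contractRight A φ z = 0) :
    z ∈ Submodule.map₂ (TensorProduct.mk k A B) F G := by
  obtain ⟨p, hp, hp'⟩ := exists_projection G
  let b := Module.Basis.ofVectorSpace k B
  have h1 : (LinearMap.id - p).lTensor A z = 0 := by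
    obtain ⟨s, hs⟩ := exists_finset_eq_sum_contractRight b ((LinearMap.id - p).lTensor A z)
    rw [hs]
    refine Finset.sum_eq_zero fun i _ => ?_
    rw [contractRight_lTensor, hG, TensorProduct.zero_tmul]
    intro x hx
    simp [hp' x hx]
  have h2 : z = p.lTensor A z := by
    rw [LinearMap.lTensor_sub, LinearMap.sub_apply, LinearMap.lTensor_id, LinearMap.id_apply,
      sub_eq_zero] at h1
    exact h1
  obtain ⟨s, hs⟩ := exists_finset_eq_sum_contractRight b z
  rw [h2, hs, map_sum]
  refine Submodule.sum_mem _ fun i _ => ?_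
  rw [LinearMap.lTensor_tmul]
  exact Submodule.apply_mem_map₂ _ (hF _) (hp _)

variable {ι : Type*} [LinearOrder ι]

theorem contractRight_mem_of_mem_iSup {F : ι → Submodule k A} {G : ι → Submodule k B}
    (hF : Antitone F) {W : Finset ι} {z : A ⊗[k] B}
    (hz : z ∈ ⨆ i ∈ W, Submodule.map₂ (TensorProduct.mk k A B) (F i) (G i)) {i : ι}
    {φ : B →ₗ[k] k} (hφ : ∀ j ∈ W, j < i → ∀ x ∈ G j, φ x = 0) :
    contractRight A φ z ∈ F i := by
  suffices h : (⨆ i ∈ W, Submodule.map₂ (TensorProduct.mk k A B) (F i) (G i)) ≤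
      (F i).comap (contractRight A φ) from h hz
  refine iSup₂_le fun j hj => Submodule.map₂_le.mpr fun a ha x hx => ?_
  rw [Submodule.mem_comap, TensorProduct.mk_apply, contractRight_tmul]
  rcases lt_or_ge j i with hji | hij
  · rw [hφ j hj hji x hx, zero_smul]
    exact Submodule.zero_mem _
  · exact Submodule.smul_mem _ _ (hF hij ha)

/-- Converse of `contractRight_mem_of_mem_iSup`, by induction on the largest index `m`. A projection
`p` onto the span of the earlier `G j` splits `z`: the `p`-part falls to the induction hypothesis,
and the complementary part lies in `F m ⊗ G m`. -/
theorem mem_iSup_map₂_of_contractRight {F : ι → Submodule k A} {G : ι → Submodule k B}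
    (hG : Monotone G) (W : Finset ι) (z : A ⊗[k] B)
    (hz : ∀ i ∈ W, ∀ φ : B →ₗ[k] k, (∀ j ∈ W, j < i → ∀ x ∈ G j, φ x = 0) →
      contractRight A φ z ∈ F i)
    (hz' : ∀ φ : B →ₗ[k] k, (∀ j ∈ W, ∀ x ∈ G j, φ x = 0) → contractRight A φ z = 0) :
    z ∈ ⨆ i ∈ W, Submodule.map₂ (TensorProduct.mk k A B) (F i) (G i) := by
  induction W using Finset.induction_on_max generalizing z with
  | empty =>
    have h : z ∈ Submodule.map₂ (TensorProduct.mk k A B) ⊥ ⊥ :=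
      mem_map₂_of_contractRight_mem ⊥ ⊥ z
        (fun φ => (Submodule.mem_bot k).mpr (hz' φ (by simp))) fun φ _ => hz' φ (by simp)
    simpa using h
  | insert m W hm ih =>
    obtain ⟨p, hp, hp'⟩ := exists_projection (⨆ j ∈ W, G j)
    have hle : ∀ j ∈ W, G j ≤ ⨆ j ∈ W, G j := fun j hj => le_iSup₂_of_le j hj le_rfl
    have hHm : (⨆ j ∈ W, G j) ≤ G m := iSup₂_le fun j hj => hG (hm j hj).le
    have hsplit : z = p.lTensor A z + (LinearMap.id - p).lTensor A z := by
      simp [LinearMap.lTensor_sub]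
    rw [hsplit, Finset.iSup_insert]
    refine add_mem (Submodule.mem_sup_right (ih _ ?_ ?_)) (Submodule.mem_sup_left
      (mem_map₂_of_contractRight_mem _ _ _ ?_ ?_))
    · intro i hi φ hφ
      rw [contractRight_lTensor]
      refine hz i (Finset.mem_insert_of_mem hi) _ fun j hj hji x hx => ?_
      have hjW : j ∈ W := by
        rcases Finset.mem_insert.mp hj with rfl | h
        · exact absurd (hm i hi) hji.not_gt
        · exact h
      rw [LinearMap.comp_apply, hp' x (hle j hjW hx)]
      exact hφ j hjW hji x hx
    · intro φ hφ
      have hker : (⨆ j ∈ W, G j) ≤ LinearMap.ker φ := iSup₂_le fun j hj x hx => hφ j hj x hx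
      rw [contractRight_lTensor]
      exact hz' _ fun j _ x _ => hker (hp x)
    · intro φ
      rw [contractRight_lTensor]
      -- Precomposing with `id - p` makes any functional kill every earlier `G j`.
      refine hz m (Finset.mem_insert_self m W) _ fun j hj hjm x hx => ?_
      have hjW : j ∈ W := (Finset.mem_insert.mp hj).resolve_left hjm.ne
      simp [hp' x (hle j hjW hx)]
    · intro φ hφ
      rw [contractRight_lTensor]
      refine hz' _ fun j hj x hx => hφ _ ?_
      have hxm : x ∈ G m := by
        rcases Finset.mem_insert.mp hj with rfl | h
        · exact hx
        · exact hG (hm j h).le hx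
      exact sub_mem hxm (hHm (hp x))

/-- Preimages under maps of the left factor commute with sums of products of two chains. -/
theorem mem_iSup_map₂_iInf_comap_left {κ : Type*} {F : ι → Submodule k A} {G : ι → Submodule k B}
    (hF : Antitone F) (hG : Monotone G) (f : κ → A →ₗ[k] A) {W : Finset ι}
    (hW : ∃ m ∈ W, G m = ⊤) {z : A ⊗[k] B}
    (hz : ∀ c, (f c).rTensor B z ∈
      ⨆ i ∈ W, Submodule.map₂ (TensorProduct.mk k A B) (F i) (G i)) :
    z ∈ ⨆ i ∈ W, Submodule.map₂ (TensorProduct.mk k A B) (⨅ c, (F i).comap (f c)) (G i) := by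
  refine mem_iSup_map₂_of_contractRight hG W z (fun i hi φ hφ => ?_) fun φ hφ => ?_
  · rw [Submodule.mem_iInf]
    intro c
    rw [Submodule.mem_comap, ← contractRight_rTensor]
    exact contractRight_mem_of_mem_iSup hF (hz c) hφ
  · obtain ⟨m, hm, hGm⟩ := hW
    -- Since some `G m` is all of `B`, the vanishing condition is vacuous.
    have h0 : φ = 0 := LinearMap.ext fun x => hφ m hm x (hGm ▸ Submodule.mem_top)
    simp [h0, contractRight]

theorem comm_lTensor (p : B →ₗ[k] B) (z : A ⊗[k] B) :
    TensorProduct.comm k A B (p.lTensor A z) = p.rTensor A (TensorProduct.comm k A B z) := by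
  induction z with
  | zero => simp
  | tmul a b => simp
  | add x y hx hy => simp only [map_add, hx, hy]

theorem comm_mem_iSup_map₂ {ι : Type*} {F : ι → Submodule k A} {G : ι → Submodule k B}
    {W : Finset ι} {z : A ⊗[k] B}
    (hz : z ∈ ⨆ i ∈ W, Submodule.map₂ (TensorProduct.mk k A B) (F i) (G i)) :
    TensorProduct.comm k A B z ∈
      ⨆ i ∈ W, Submodule.map₂ (TensorProduct.mk k B A) (G i) (F i) := by
  suffices h : (⨆ i ∈ W, Submodule.map₂ (TensorProduct.mk k A B) (F i) (G i)) ≤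
      (⨆ i ∈ W, Submodule.map₂ (TensorProduct.mk k B A) (G i) (F i)).comap
        (TensorProduct.comm k A B).toLinearMap from h hz
  refine iSup₂_le fun i hi => Submodule.map₂_le.mpr fun a ha b hb => ?_
  exact Submodule.mem_iSup_of_mem i (Submodule.mem_iSup_of_mem hi
    (Submodule.apply_mem_map₂ (TensorProduct.mk k B A) hb ha))

/-- Preimages under maps of the right factor commute with sums of products of two chains. -/
theorem mem_iSup_map₂_iInf_comap_right {κ : Type*} {F : ι → Submodule k A} {G : ι → Submodule k B}
    (hF : Antitone F) (hG : Monotone G) (g : κ → B →ₗ[k] B) {W : Finset ι}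
    (hW : ∃ m ∈ W, F m = ⊤) {z : A ⊗[k] B}
    (hz : ∀ c, (g c).lTensor A z ∈
      ⨆ i ∈ W, Submodule.map₂ (TensorProduct.mk k A B) (F i) (G i)) :
    z ∈ ⨆ i ∈ W, Submodule.map₂ (TensorProduct.mk k A B) (F i) (⨅ c, (G i).comap (g c)) := by
  -- Swapping the factors exchanges the roles of the chains, so the index order is reversed.
  have h := mem_iSup_map₂_iInf_comap_left (ι := ιᵒᵈ) (F := fun i => G (OrderDual.ofDual i))
    (G := fun i => F (OrderDual.ofDual i)) (fun i j hij => hG hij) (fun i j hij => hF hij) g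
    (W := W) (z := TensorProduct.comm k A B z) hW fun c => by
      rw [← comm_lTensor]
      exact comm_mem_iSup_map₂ (hz c)
  have h' := comm_mem_iSup_map₂ (ι := ι) h
  rwa [← TensorProduct.comm_symm, LinearEquiv.symm_apply_apply] at h'

end Chain

/-! ### Monotonicity of rational powers -/

section Powers

variable {R : Type*} [CommRing R]

theorem integralClosure_mono {I J : Ideal R} (h : I ≤ J) : integralClosure I ≤ integralClosure J :=
  fun _ ⟨f, hf, hc, he⟩ => ⟨f, hf, fun i => Ideal.pow_right_mono h _ (hc i), he⟩

theorem rationalPower_zero (I : Ideal R) : rationalPower I 0 = ⊤ := by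
  rw [eq_top_iff]
  intro x _
  rw [mem_rationalPower_iff I 0 0 1 one_pos (by simp)]
  exact ⟨Polynomial.X - Polynomial.C (x ^ 1), Polynomial.monic_X_sub_C _,
    fun i => by simp [Ideal.one_eq_top, Ideal.top_pow], by simp⟩

theorem rationalPower_antitone (I : Ideal R) : Antitone (rationalPower I) := by
  intro v w h x hx
  have hv : (v.den : ℚ≥0) ≠ 0 := by exact_mod_cast v.den_pos.ne'
  have hw : (w.den : ℚ≥0) ≠ 0 := by exact_mod_cast w.den_pos.ne'
  have hq : 0 < v.den * w.den := Nat.mul_pos v.den_pos w.den_pos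
  have ev : v = ((v.num * w.den : ℕ) : ℚ≥0) / ((v.den * w.den : ℕ) : ℚ≥0) := by
    push_cast
    rw [mul_div_mul_right _ _ hw, NNRat.num_div_den]
  have ew : w = ((v.den * w.num : ℕ) : ℚ≥0) / ((v.den * w.den : ℕ) : ℚ≥0) := by
    push_cast
    rw [mul_div_mul_left _ _ hv, NNRat.num_div_den]
  have hpos : (0 : ℚ≥0) < ((v.den * w.den : ℕ) : ℚ≥0) := by exact_mod_cast hq
  have hle : v.num * w.den ≤ v.den * w.num := by
    have h' := h
    replace h' := ev.symm.trans_le (h'.trans_eq ew)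
    rw [div_le_div_iff_of_pos_right hpos] at h'
    exact_mod_cast h'
  rw [mem_rationalPower_iff I w _ _ hq ew] at hx
  rw [mem_rationalPower_iff I v _ _ hq ev]
  exact integralClosure_mono (Ideal.pow_le_pow_right hle) hx

end Powers

/-! ### Ideals of the tensor product as `k`-subspaces -/

section Tensor

variable {k A B : Type*} [Field k] [CommRing A] [CommRing B] [Algebra k A] [Algebra k B]

theorem tmul_mem_mixedProd {I : Ideal A} {J : Ideal B} {a : A} {b : B} (ha : a ∈ I) (hb : b ∈ J) :
    a ⊗ₜ[k] b ∈ mixedProd k I J := by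
  have h : a ⊗ₜ[k] b = (a ⊗ₜ[k] (1 : B)) * ((1 : A) ⊗ₜ[k] b) := by simp
  rw [h]
  exact Ideal.mul_mem_mul (Ideal.mem_map_of_mem _ ha) (Ideal.mem_map_of_mem _ hb)

theorem mixedProd_le {I : Ideal A} {J : Ideal B} {N : Ideal (A ⊗[k] B)}
    (h : ∀ a ∈ I, ∀ b ∈ J, a ⊗ₜ[k] b ∈ N) : mixedProd k I J ≤ N := by
  rw [mixedProd, extLeft, extRight, Ideal.map, Ideal.map, Ideal.span_mul_span', Ideal.span_le]
  rintro _ ⟨_, ⟨a, ha, rfl⟩, _, ⟨b, hb, rfl⟩, rfl⟩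
  simpa using h a ha b hb

theorem mixedProd_pow (K : Ideal A) (L : Ideal B) (t : ℕ) :
    mixedProd k K L ^ t = mixedProd k (K ^ t) (L ^ t) := by
  simp [mixedProd, extLeft, extRight, mul_pow, Ideal.map_pow]

/-- The `k`-span of the pure tensors is stable under multiplication by pure tensors, hence is
already an ideal. -/
theorem restrictScalars_mixedProd (I : Ideal A) (J : Ideal B) :
    (mixedProd k I J).restrictScalars k = Submodule.map₂ (TensorProduct.mk k A B)
      (I.restrictScalars k) (J.restrictScalars k) := by
  refine le_antisymm ?_ (Submodule.map₂_le.mpr fun a ha b hb => tmul_mem_mixedProd ha hb)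
  set T := Submodule.map₂ (TensorProduct.mk k A B) (I.restrictScalars k) (J.restrictScalars k)
  have hT : ∀ r : A ⊗[k] B, T ≤ T.comap (LinearMap.mulLeft k r) := by
    intro r
    induction r with
    | zero =>
      intro x _
      simp
    | tmul c d =>
      refine Submodule.map₂_le.mpr fun a ha b hb => ?_
      simp only [Submodule.mem_comap, LinearMap.mulLeft_apply, TensorProduct.mk_apply,
        Algebra.TensorProduct.tmul_mul_tmul]
      exact Submodule.apply_mem_map₂ (TensorProduct.mk k A B) (I.mul_mem_left c ha)
        (J.mul_mem_left d hb)
    | add x y hx hy =>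
      intro z hz
      have h := add_mem (Submodule.mem_comap.mp (hx hz)) (Submodule.mem_comap.mp (hy hz))
      simpa [add_mul] using h
  let N : Ideal (A ⊗[k] B) := { T with smul_mem' := fun r x hx => hT r hx }
  exact fun x hx => (mixedProd_le (N := N) fun a ha b hb =>
    Submodule.apply_mem_map₂ (TensorProduct.mk k A B) ha hb) hx

theorem rTensor_mulRight_lTensor_mulRight (a : A) (b : B) (z : A ⊗[k] B) :
    (LinearMap.mulRight k a).rTensor B ((LinearMap.mulRight k b).lTensor A z) =
      z * a ⊗ₜ[k] b := by
  induction z with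
  | zero => simp
  | tmul x y => simp
  | add x y hx hy => simp only [map_add, add_mul, hx, hy]

theorem restrictScalars_biSup {ι : Type*} (W : Finset ι) (N : ι → Ideal (A ⊗[k] B)) :
    (⨆ i ∈ W, N i).restrictScalars k = ⨆ i ∈ W, (N i).restrictScalars k := by
  simp only [Submodule.restrictScalars_iSup]

theorem mem_of_mem_iSup_map₂ {ι : Type*} {W : Finset ι} {F : ι → Submodule k A} {G : ι → Submodule k B}
    {N : Ideal (A ⊗[k] B)} (h : ∀ i ∈ W, ∀ a ∈ F i, ∀ b ∈ G i, a ⊗ₜ[k] b ∈ N) {z : A ⊗[k] B}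
    (hz : z ∈ ⨆ i ∈ W, Submodule.map₂ (TensorProduct.mk k A B) (F i) (G i)) : z ∈ N := by
  have hle : (⨆ i ∈ W, Submodule.map₂ (TensorProduct.mk k A B) (F i) (G i)) ≤
      N.restrictScalars k := iSup₂_le fun i hi => Submodule.map₂_le.mpr (h i hi)
  exact hle hz

end Tensor

end RatPower

/-! ### The binomial formula for saturated powers -/

open RatPower in
theorem mainTheorem9 {k A B : Type*} [Field k] [CommRing A] [CommRing B] [Algebra k A] [Algebra k B]
    [IsNoetherianRing A] [IsNoetherianRing B] [IsNoetherianRing (A ⊗[k] B)]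
    (I K : Ideal A) (J L : Ideal B) (u : ℚ≥0) (hu : 0 < u)
    (h : RatPower.BinomialExpansion k I J u) :
    RatPower.saturatedPower (RatPower.mixedSum k I J) (RatPower.mixedProd k K L) u =
      ⨆ (w : ℚ≥0) (_ : w ≤ u),
        RatPower.mixedProd k (RatPower.saturatedPower I K w)
          (RatPower.saturatedPower J L (u - w)) := by
  classical
  apply le_antisymm
  · rintro z ⟨t, ht⟩
    rw [show rationalPower (mixedSum k I J) u = _ from h] at ht
    have hle : Ideal.span {z} * mixedProd k K L ^ t ≤ ⨆ w : Set.Iic u,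
        mixedProd k (rationalPower I w) (rationalPower J (u - w)) := by
      rw [iSup_subtype]
      exact Ideal.span_singleton_mul_le_iff.mpr ht
    obtain ⟨W₀, hW₀⟩ := CompleteLattice.IsCompactElement.exists_finset_of_le_iSup _
      -- A finitely generated ideal is compact, so finitely many exponents suffice.
      ((Submodule.fg_iff_compact _).mp (IsNoetherian.noetherian
        (Ideal.span {z} * mixedProd k K L ^ t))) _ hle
    -- The endpoints are added so that some `F w` is all of `A` (`w = 0`) and some `G w` is all of
    -- `B` (`w = u`).
    let W : Finset (Set.Iic u) := insert ⟨0, Set.mem_Iic.mpr zero_le⟩ (insert ⟨u, Set.self_mem_Iic⟩ W₀)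
    let F : Set.Iic u → Submodule k A := fun w => (rationalPower I w).restrictScalars k
    let G : Set.Iic u → Submodule k B := fun w => (rationalPower J (u - w)).restrictScalars k
    have hF : Antitone F := fun v w hvw => rationalPower_antitone I hvw
    have hG : Monotone G := fun v w hvw => rationalPower_antitone J
      (tsub_le_tsub_left (Subtype.coe_le_coe.mpr hvw) u)
    have hmem : ∀ a ∈ K ^ t, ∀ b ∈ L ^ t, z * a ⊗ₜ[k] b ∈
        ⨆ i ∈ W, Submodule.map₂ (TensorProduct.mk k A B) (F i) (G i) := by
      intro a ha b hb
      have h1 := hW₀ (Ideal.mul_mem_mul (Ideal.mem_span_singleton_self z)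
        (by rw [mixedProd_pow]; exact tmul_mem_mixedProd ha hb))
      have h2 := (biSup_mono (f := fun w : Set.Iic u =>
        mixedProd k (rationalPower I w) (rationalPower J (u - w))) (fun i hi =>
          Finset.mem_insert_of_mem (Finset.mem_insert_of_mem hi) :
            ∀ i, i ∈ W₀ → i ∈ W)) h1
      rw [← Submodule.restrictScalars_mem k, restrictScalars_biSup] at h2
      simpa only [restrictScalars_mixedProd] using h2
    -- Multiplication by `a ⊗ b` factors through the two sides: `b` is fixed while the colon by `K ^
    -- t` moves inside, then `b` varies.
    have hleft : ∀ b : (L ^ t : Ideal B), (LinearMap.mulRight k (b : B)).lTensor A z ∈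
        ⨆ i ∈ W, Submodule.map₂ (TensorProduct.mk k A B)
          (⨅ a : (K ^ t : Ideal A), (F i).comap (LinearMap.mulRight k (a : A))) (G i) := by
      intro b
      refine mem_iSup_map₂_iInf_comap_left hF hG _ ⟨⟨u, Set.self_mem_Iic⟩, by simp [W], ?_⟩
        fun a => ?_
      · simp [G, rationalPower_zero]
      · rw [rTensor_mulRight_lTensor_mulRight]
        exact hmem a a.2 b b.2
    have hz := mem_iSup_map₂_iInf_comap_right (F := fun w => ⨅ a : (K ^ t : Ideal A),
        (F w).comap (LinearMap.mulRight k (a : A)))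
      (fun v w hvw => iInf_mono fun a => Submodule.comap_mono (hF hvw)) hG
      (fun b : (L ^ t : Ideal B) => LinearMap.mulRight k (b : B))
      ⟨⟨0, Set.mem_Iic.mpr zero_le⟩, by simp [W], by simp [F, rationalPower_zero]⟩ hleft
    refine mem_of_mem_iSup_map₂ (fun w _ a ha b hb => ?_) hz
    have ha' : a ∈ saturatedPower I K w :=
      ⟨t, fun y hy => (Submodule.mem_iInf _).mp ha ⟨y, hy⟩⟩
    have hb' : b ∈ saturatedPower J L (u - w) :=
      ⟨t, fun y hy => (Submodule.mem_iInf _).mp hb ⟨y, hy⟩⟩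
    exact Submodule.mem_iSup_of_mem w.1 (Submodule.mem_iSup_of_mem w.2
      (tmul_mem_mixedProd ha' hb'))
  · refine iSup₂_le fun w hw => mixedProd_le ?_
    rintro a ⟨s, hs⟩ b ⟨t, ht⟩
    refine ⟨s + t, ?_⟩
    rw [show rationalPower (mixedSum k I J) u = _ from h, mixedProd_pow]
    -- Through a colon ideal, the check reduces to pure tensors `c ⊗ d`; the exponent `s + t` serves
    -- both factors.
    have hN := mixedProd_le (k := k) (I := K ^ (s + t)) (J := L ^ (s + t))
      (N := Submodule.colon (mixedProd k (rationalPower I w) (rationalPower J (u - w)))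
        {a ⊗ₜ[k] b}) fun c hc d hd => by
          rw [Submodule.mem_colon_singleton, smul_eq_mul, mul_comm,
            Algebra.TensorProduct.tmul_mul_tmul]
          exact tmul_mem_mixedProd (hs c (Ideal.pow_le_pow_right (Nat.le_add_right s t) hc))
            (ht d (Ideal.pow_le_pow_right (Nat.le_add_left t s) hd))
    intro y hy
    have hy' := hN hy
    rw [Submodule.mem_colon_singleton, smul_eq_mul, mul_comm] at hy'
    exact Submodule.mem_iSup_of_mem w (Submodule.mem_iSup_of_mem hw hy')
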